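/- A pomonoid is a monoid with a partial order for which multiplication is monotone in both arguments. Let $[U;S_1,S_2]$ be a pomonoid amalgam, i.e. $U,S_1,S_2$ are pomonoids and $\iota_i:U\to S_i$ ($i=1,2$) are pomonoid morphisms that are order embeddings. Let $S_1*_US_2$ be the amalgamated free product, i.e. the pushout of $S_1\leftarrow U\to S_2$ in the category of pomonoids; write $(s_1,\dots,s_n)$ for the product in $S_1*_US_2$ of the images of $s_1,\dots,s_n$. A right $S$-poset is a nonempty poset with a right action of $S$ that is monotone in both variables; left $S$-posets are dual, and a $(U,V)$-poset carries commuting actions of $U$ on the left and of $V$ on the right. Morphisms are the monotone equivariant maps. All tensor products are taken over $U$ in the category of posets with action. Define $(U,U)$-posets $Y_n$ and morphisms $k_n:Y_n\to Y_{n+1}$ ($n\ge1$) as follows. Put $Y_1=S_1$, $Y_2=S_1\otimes S_2$ and $k_1(s)=s\otimes1$. For $n\ge3$ let $i\in\{1,2\}$ with $i\equiv n\pmod 2$; then $Y_{n-2}$ is a right $S_i$-poset, and we put $$Y_n=(Y_{n-1}\otimes S_i)/\delta_{n-2},\qquad k_{n-1}(y)=(y\otimes1)\delta_{n-2}.$$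 Here $\delta_{n-2}$ is the right $S_i$-poset congruence induced by $$V_{n-2}=\{(k_{n-2}(y)\otimes s,\;k_{n-2}(y')\otimes s')\;:\;y,y'\in Y_{n-2},\ s,s'\in S_i,\ ys\le y's'\}.$$ That is, let $\preceq$ be the smallest preorder on $Y_{n-1}\otimes S_i$ that contains its order and all pairs $(pt,qt)$ with $(p,q)\in V_{n-2}$ and $t\in S_i$; then $a\,\delta_{n-2}\,b$ means $a\preceq b\preceq a$, and $Y_n$ is ordered by $\preceq$. The left $U$-action is the one inherited from $S_1$, and $U$ acts on the right of $Y_n$ through $S_i$. Write $[s_1]=s_1$, $[s_1,s_2]=s_1\otimes s_2$ and $[s_1,\dots,s_n]=([s_1,\dots,s_{n-1}]\otimes s_n)\delta_{n-2}$ for $n\ge3$, where $s_j\in S_1$ for $j$ odd and $s_j\in S_2$ for $j$ even. **Theorem.** The assignments $\varphi_n([s_1,\dots,s_n])=(s_1,\dots,s_n)$ give well-defined morphisms of $(U,U)$-posets $\varphi_n:Y_n\to S_1*_US_2$, and $(S_1*_US_2,(\varphi_n)_{n\ge1})$ is the direct limit, in the category of $(U,U)$-posets, of the direct system $(Y_n,k_n)_{n\ge1}$.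 -/

import Mathlib

universe u v w x y z

/-! ### Ordered quotients -/

/-- The equivalence relation `a ≤ᵣ b ≤ᵣ a`, where `≤ᵣ` is the preorder generated by `r`. -/
def ordSetoid {A : Type w} (r : A → A → Prop) : Setoid A where
  r a b := Relation.ReflTransGen r a b ∧ Relation.ReflTransGen r b a
  iseqv :=
    ⟨fun _ => ⟨.refl, .refl⟩, fun h => ⟨h.2, h.1⟩, fun h k => ⟨h.1.trans k.1, k.2.trans h.2⟩⟩

/-- The poset obtained from the preorder generated by `r` by identifying `a` and `b` whenever
`a ≤ᵣ b ≤ᵣ a`. -/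
def OrdQuot {A : Type w} (r : A → A → Prop) : Type w := Quotient (ordSetoid r)

namespace OrdQuot

variable {A : Type w} {B : Type x} {r : A → A → Prop} {q : B → B → Prop}

/-- The class of an element. -/
def mk (r : A → A → Prop) (a : A) : OrdQuot r := Quotient.mk (ordSetoid r) a

/-- Classes are ordered by `mk a ≤ mk b ↔ a ≤ᵣ b`. -/
instance : PartialOrder (OrdQuot r) where
  le := Quotient.lift₂ (fun a b => Relation.ReflTransGen r a b) (fun _ _ _ _ h k =>
    propext ⟨fun l => (h.2.trans l).trans k.1, fun l => (h.1.trans l).trans k.2⟩)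
  le_refl := by rintro ⟨a⟩; exact Relation.ReflTransGen.refl
  le_trans := by rintro ⟨a⟩ ⟨b⟩ ⟨c⟩ h k; exact Relation.ReflTransGen.trans h k
  le_antisymm := by rintro ⟨a⟩ ⟨b⟩ h k; exact Quotient.sound ⟨h, k⟩

theorem mk_le_mk {a b : A} : mk r a ≤ mk r b ↔ Relation.ReflTransGen r a b := Iff.rfl

theorem mk_le_of {a b : A} (h : r a b) : mk r a ≤ mk r b := Relation.ReflTransGen.single h

theorem gen_le {C : Type y} [Preorder C] {f : A → C} (h : ∀ a b, r a b → f a ≤ f b)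
    {a b : A} (hab : Relation.ReflTransGen r a b) : f a ≤ f b := by
  induction hab with
  | refl => exact le_rfl
  | tail _ k ih => exact ih.trans (h _ _ k)

/-- A map into a poset that is monotone with respect to `r` factors through the quotient. -/
def lift {C : Type y} [PartialOrder C] (f : A → C) (h : ∀ a b, r a b → f a ≤ f b) :
    OrdQuot r → C :=
  Quotient.lift f (fun _ _ k => le_antisymm (gen_le h k.1) (gen_le h k.2))

theorem lift_mono {C : Type y} [PartialOrder C] (f : A → C) (h : ∀ a b, r a b → f a ≤ f b)
    {a b : OrdQuot r} (hab : a ≤ b) : lift f h a ≤ lift f h b := by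
  induction a using Quotient.inductionOn
  induction b using Quotient.inductionOn
  exact gen_le h hab

theorem ind {p : OrdQuot r → Prop} (h : ∀ a, p (mk r a)) (a : OrdQuot r) : p a :=
  Quotient.inductionOn a h

end OrdQuot

/-! ### Biposets -/

/-- An `(S,T)`-poset for pomonoids `S` and `T`: a nonempty poset with a left `S`-action `lact`
and a right `T`-action `ract` which commute and are monotone in both variables. -/
structure BiPoset (S : Type u) (T : Type v) [Monoid S] [PartialOrder S] [Monoid T]
    [PartialOrder T] where
  carrier : Type w
  [order : PartialOrder carrier]
  nonempty : Nonempty carrier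
  lact : S → carrier → carrier
  ract : carrier → T → carrier
  one_lact : ∀ a, lact 1 a = a
  mul_lact : ∀ s s' a, lact (s * s') a = lact s (lact s' a)
  ract_one : ∀ a, ract a 1 = a
  ract_mul : ∀ a t t', ract a (t * t') = ract (ract a t) t'
  lact_ract : ∀ s a t, ract (lact s a) t = lact s (ract a t)
  lact_le : ∀ {s s' a a'}, s ≤ s' → a ≤ a' → lact s a ≤ lact s' a'
  ract_le : ∀ {a a' t t'}, a ≤ a' → t ≤ t' → ract a t ≤ ract a' t'

attribute [instance] BiPoset.order

/-- A morphism of `(S,T)`-posets: a monotone map commuting with both actions. -/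
@[ext]
structure BiHom {S : Type u} {T : Type v} [Monoid S] [PartialOrder S] [Monoid T]
    [PartialOrder T] (A : BiPoset.{u, v, w} S T) (B : BiPoset.{u, v, x} S T) where
  toFun : A.carrier → B.carrier
  mono : ∀ {a a'}, a ≤ a' → toFun a ≤ toFun a'
  map_lact : ∀ s a, toFun (A.lact s a) = B.lact s (toFun a)
  map_ract : ∀ a t, toFun (A.ract a t) = B.ract (toFun a) t

namespace BiHom

variable {S : Type u} {T : Type v} [Monoid S] [PartialOrder S] [Monoid T] [PartialOrder T]

/-- The identity morphism. -/
def id (A : BiPoset.{u, v, w} S T) : BiHom A A where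
  toFun a := a
  mono h := h
  map_lact _ _ := rfl
  map_ract _ _ := rfl

/-- The composite `g ∘ f`. -/
def comp {A : BiPoset.{u, v, w} S T} {B : BiPoset.{u, v, x} S T} {C : BiPoset.{u, v, y} S T}
    (g : BiHom B C) (f : BiHom A B) : BiHom A C where
  toFun a := g.toFun (f.toFun a)
  mono h := g.mono (f.mono h)
  map_lact s a := by rw [f.map_lact, g.map_lact]
  map_ract a t := by rw [f.map_ract, g.map_ract]

end BiHom

namespace BiPoset

/-- Restriction of the right action along a pomonoid morphism. -/
def restrict {R : Type u} {S : Type v} {U : Type x} [Monoid R] [PartialOrder R]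
    [Monoid S] [PartialOrder S] [Monoid U] [PartialOrder U]
    (A : BiPoset.{u, v, w} R S) (ι : U →*o S) : BiPoset.{u, x, w} R U where
  carrier := A.carrier
  nonempty := A.nonempty
  lact := A.lact
  ract a t := A.ract a (ι t)
  one_lact := A.one_lact
  mul_lact := A.mul_lact
  ract_one a := by rw [map_one, A.ract_one]
  ract_mul a t t' := by rw [map_mul, A.ract_mul]
  lact_ract s a t := A.lact_ract s a (ι t)
  lact_le := A.lact_le
  ract_le h k := A.ract_le h (ι.monotone' k)

/-! ### Tensor products -/

section Tensor

variable {R : Type u} {S : Type v} {T : Type x} [Monoid R] [PartialOrder R]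
  [Monoid S] [PartialOrder S] [Monoid T] [PartialOrder T]
  (A : BiPoset.{u, v, w} R S) (B : BiPoset.{v, x, y} S T)

/-- The order of `A × B` together with `(as, b) ≤ (a, sb)` and `(a, sb) ≤ (as, b)`. -/
def tensorRel (p q : A.carrier × B.carrier) : Prop :=
  p ≤ q ∨ (∃ a s b, p = (A.ract a s, b) ∧ q = (a, B.lact s b)) ∨
    (∃ a s b, p = (a, B.lact s b) ∧ q = (A.ract a s, b))

/-- The element `a ⊗ b` of `A ⊗ B`. -/
def tmk (a : A.carrier) (b : B.carrier) : OrdQuot (tensorRel A B) := OrdQuot.mk _ (a, b)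

theorem tmk_le {a a' : A.carrier} {b b' : B.carrier} (h : a ≤ a') (k : b ≤ b') :
    tmk A B a b ≤ tmk A B a' b' :=
  OrdQuot.mk_le_of (Or.inl ⟨h, k⟩)

theorem tmk_balanced (a : A.carrier) (s : S) (b : B.carrier) :
    tmk A B (A.ract a s) b = tmk A B a (B.lact s b) :=
  le_antisymm (OrdQuot.mk_le_of (Or.inr (Or.inl ⟨a, s, b, rfl, rfl⟩)))
    (OrdQuot.mk_le_of (Or.inr (Or.inr ⟨a, s, b, rfl, rfl⟩)))

theorem tlact_aux (r : R) (p q : A.carrier × B.carrier) (h : tensorRel A B p q) :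
    tmk A B (A.lact r p.1) p.2 ≤ tmk A B (A.lact r q.1) q.2 := by
  rcases h with h | ⟨a, s, b, rfl, rfl⟩ | ⟨a, s, b, rfl, rfl⟩
  · exact tmk_le A B (A.lact_le le_rfl h.1) h.2
  · simp only [← A.lact_ract, tmk_balanced, le_refl]
  · simp only [← A.lact_ract, tmk_balanced, le_refl]

theorem tract_aux (t : T) (p q : A.carrier × B.carrier) (h : tensorRel A B p q) :
    tmk A B p.1 (B.ract p.2 t) ≤ tmk A B q.1 (B.ract q.2 t) := by
  rcases h with h | ⟨a, s, b, rfl, rfl⟩ | ⟨a, s, b, rfl, rfl⟩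
  · exact tmk_le A B h.1 (B.ract_le h.2 le_rfl)
  · simp only [B.lact_ract, tmk_balanced, le_refl]
  · simp only [B.lact_ract, tmk_balanced, le_refl]

/-- The tensor product `A ⊗ B` over `S` of an `(R,S)`-poset and an `(S,T)`-poset, with the actions
`r(a ⊗ b) = ra ⊗ b` and `(a ⊗ b)t = a ⊗ bt`. -/
def tensor : BiPoset.{u, x, max w y} R T where
  carrier := OrdQuot (tensorRel A B)
  nonempty := ⟨tmk A B A.nonempty.some B.nonempty.some⟩
  lact r := OrdQuot.lift (fun p => tmk A B (A.lact r p.1) p.2) (tlact_aux A B r)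
  ract c t := OrdQuot.lift (fun p => tmk A B p.1 (B.ract p.2 t)) (tract_aux A B t) c
  one_lact := OrdQuot.ind fun p => by
    change tmk A B (A.lact 1 p.1) p.2 = tmk A B p.1 p.2
    rw [A.one_lact]
  mul_lact r r' := OrdQuot.ind fun p => by
    change tmk A B (A.lact (r * r') p.1) p.2 = tmk A B (A.lact r (A.lact r' p.1)) p.2
    rw [A.mul_lact]
  ract_one := OrdQuot.ind fun p => by
    change tmk A B p.1 (B.ract p.2 1) = tmk A B p.1 p.2
    rw [B.ract_one]
  ract_mul c t t' := by
    revert c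
    refine OrdQuot.ind fun p => ?_
    change tmk A B p.1 (B.ract p.2 (t * t')) = tmk A B p.1 (B.ract (B.ract p.2 t) t')
    rw [B.ract_mul]
  lact_ract r c t := by
    revert c
    exact OrdQuot.ind fun _ => rfl
  lact_le {r r' c c'} h k :=
    (OrdQuot.lift_mono _ (tlact_aux A B r) k).trans
      (OrdQuot.ind (p := fun c => OrdQuot.lift _ (tlact_aux A B r) c ≤
        OrdQuot.lift _ (tlact_aux A B r') c)
        (fun _ => tmk_le A B (A.lact_le h le_rfl) le_rfl) c')
  ract_le {c c' t t'} h k :=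
    (OrdQuot.lift_mono _ (tract_aux A B t) h).trans
      (OrdQuot.ind (p := fun c => OrdQuot.lift _ (tract_aux A B t) c ≤
        OrdQuot.lift _ (tract_aux A B t') c)
        (fun _ => tmk_le A B le_rfl (B.ract_le le_rfl k)) c')

/-- The element `a ⊗ b` of the `(R,T)`-poset `A ⊗ B`. -/
def tens (a : A.carrier) (b : B.carrier) : (tensor A B).carrier := tmk A B a b

end Tensor

/-! ### Quotients by induced congruences -/

section Induced

variable {R : Type u} {T : Type v} [Monoid R] [PartialOrder R] [Monoid T] [PartialOrder T]
  (A : BiPoset.{u, v, w} R T) (ρ : A.carrier → A.carrier → Prop)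

/-- The order of `A` together with `xt ≤ x't` for `(x, x') ∈ ρ` and `t ∈ T`. The preorder it
generates is the order of the quotient of `A` by the right `T`-poset congruence induced by `ρ`. -/
def inducedRel (a b : A.carrier) : Prop :=
  a ≤ b ∨ ∃ x x' t, ρ x x' ∧ a = A.ract x t ∧ b = A.ract x' t

theorem qlact_aux (hρ : ∀ r x x', ρ x x' → ρ (A.lact r x) (A.lact r x')) (r : R)
    (a b : A.carrier) (h : inducedRel A ρ a b) :
    OrdQuot.mk (inducedRel A ρ) (A.lact r a) ≤ OrdQuot.mk (inducedRel A ρ) (A.lact r b) := by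
  refine OrdQuot.mk_le_of ?_
  rcases h with h | ⟨x, x', t, h, rfl, rfl⟩
  · exact Or.inl (A.lact_le le_rfl h)
  · exact Or.inr ⟨_, _, t, hρ r x x' h, (A.lact_ract _ _ _).symm, (A.lact_ract _ _ _).symm⟩

theorem qract_aux (t : T) (a b : A.carrier) (h : inducedRel A ρ a b) :
    OrdQuot.mk (inducedRel A ρ) (A.ract a t) ≤ OrdQuot.mk (inducedRel A ρ) (A.ract b t) := by
  refine OrdQuot.mk_le_of ?_
  rcases h with h | ⟨x, x', s, h, rfl, rfl⟩
  · exact Or.inl (A.ract_le h le_rfl)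
  · exact Or.inr ⟨x, x', s * t, h, (A.ract_mul _ _ _).symm, (A.ract_mul _ _ _).symm⟩

/-- The quotient of an `(R,T)`-poset by the right `T`-poset congruence induced by a relation `ρ`
which is stable under the left action of `R`. -/
def induced (hρ : ∀ r x x', ρ x x' → ρ (A.lact r x) (A.lact r x')) : BiPoset.{u, v, w} R T where
  carrier := OrdQuot (inducedRel A ρ)
  nonempty := ⟨OrdQuot.mk _ A.nonempty.some⟩
  lact r := OrdQuot.lift (fun a => OrdQuot.mk _ (A.lact r a)) (qlact_aux A ρ hρ r)
  ract c t := OrdQuot.lift (fun a => OrdQuot.mk _ (A.ract a t)) (qract_aux A ρ t) c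
  one_lact := OrdQuot.ind fun a => congrArg (OrdQuot.mk _) (A.one_lact a)
  mul_lact r r' := OrdQuot.ind fun a => congrArg (OrdQuot.mk _) (A.mul_lact r r' a)
  ract_one := OrdQuot.ind fun a => congrArg (OrdQuot.mk _) (A.ract_one a)
  ract_mul c t t' := by
    revert c
    exact OrdQuot.ind fun a => congrArg (OrdQuot.mk _) (A.ract_mul a t t')
  lact_ract r c t := by
    revert c
    exact OrdQuot.ind fun a => congrArg (OrdQuot.mk _) (A.lact_ract r a t)
  lact_le {r r' c c'} h k :=
    (OrdQuot.lift_mono _ (qlact_aux A ρ hρ r) k).trans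
      (OrdQuot.ind (p := fun c => OrdQuot.lift _ (qlact_aux A ρ hρ r) c ≤
        OrdQuot.lift _ (qlact_aux A ρ hρ r') c)
        (fun _ => OrdQuot.mk_le_of (Or.inl (A.lact_le h le_rfl))) c')
  ract_le {c c' t t'} h k :=
    (OrdQuot.lift_mono _ (qract_aux A ρ t) h).trans
      (OrdQuot.ind (p := fun c => OrdQuot.lift _ (qract_aux A ρ t) c ≤
        OrdQuot.lift _ (qract_aux A ρ t') c)
        (fun _ => OrdQuot.mk_le_of (Or.inl (A.ract_le le_rfl k))) c')

end Induced

end BiPoset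

/-! ### Pomonoids with a morphism from the core, and free extensions -/

/-- A pomonoid together with a pomonoid morphism from `U`. -/
structure PomonoidUnder (U : Type v) [Monoid U] [PartialOrder U] where
  carrier : Type u
  [monoid : Monoid carrier]
  [order : PartialOrder carrier]
  [mulLeftMono : MulLeftMono carrier]
  [mulRightMono : MulRightMono carrier]
  ι : U →*o carrier

attribute [instance] PomonoidUnder.monoid PomonoidUnder.order PomonoidUnder.mulLeftMono
  PomonoidUnder.mulRightMono

section FreeExtension

variable {U : Type v} [Monoid U] [PartialOrder U]

/-- `S` as a `(U,S)`-poset, with `U` acting through the given morphism `U → S`. -/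
def PomonoidUnder.biposet (S : PomonoidUnder.{u, v} U) :
    BiPoset.{v, u, u} U S.carrier where
  carrier := S.carrier
  nonempty := ⟨1⟩
  lact a s := S.ι a * s
  ract s t := s * t
  one_lact s := by rw [map_one, one_mul]
  mul_lact a b s := by rw [map_mul, mul_assoc]
  ract_one := mul_one
  ract_mul s t t' := (mul_assoc s t t').symm
  lact_ract a s t := mul_assoc _ s t
  lact_le h k := mul_le_mul' (S.ι.monotone' h) k
  ract_le h k := mul_le_mul' h k

/-- The `(U,S)`-poset `Y ⊗ S` (over `U`). -/
def tensorS (S : PomonoidUnder.{u, v} U) (Y : BiPoset.{v, v, u} U U) :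
    BiPoset.{v, u, u} U S.carrier :=
  BiPoset.tensor Y S.biposet

/-- The element `y ⊗ s` of `Y ⊗ S`. -/
def tensS (S : PomonoidUnder.{u, v} U) (Y : BiPoset.{v, v, u} U U) (y : Y.carrier)
    (s : S.carrier) : (tensorS S Y).carrier :=
  BiPoset.tens Y S.biposet y s

/-- The map `Y → Y ⊗ S`, `y ↦ y ⊗ 1`. -/
def tensorUnit (S : PomonoidUnder.{u, v} U) (Y : BiPoset.{v, v, u} U U) :
    BiHom Y ((tensorS S Y).restrict S.ι) where
  toFun y := tensS S Y y 1
  mono h := BiPoset.tmk_le _ _ h le_rfl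
  map_lact _ _ := rfl
  map_ract y a := by
    exact (BiPoset.tmk_balanced Y S.biposet y a (1 : S.carrier)).trans
      (congrArg (BiPoset.tmk Y S.biposet y)
        ((mul_one (S.ι a)).trans (one_mul (S.ι a)).symm))

/-- The relation `{(f(x) ⊗ s, f(x') ⊗ s') : xs ≤ x's'}` on `Y ⊗ S`. -/
def freeExtRel (S : PomonoidUnder.{u, v} U) (X : BiPoset.{v, u, u} U S.carrier)
    (Y : BiPoset.{v, v, u} U U) (f : BiHom (X.restrict S.ι) Y)
    (p q : (tensorS S Y).carrier) : Prop :=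
  ∃ (x x' : X.carrier) (s s' : S.carrier), X.ract x s ≤ X.ract x' s' ∧
    p = tensS S Y (f.toFun x) s ∧ q = tensS S Y (f.toFun x') s'

theorem freeExtRel_lact (S : PomonoidUnder.{u, v} U) (X : BiPoset.{v, u, u} U S.carrier)
    (Y : BiPoset.{v, v, u} U U) (f : BiHom (X.restrict S.ι) Y) (a : U)
    (p q : (tensorS S Y).carrier) (h : freeExtRel S X Y f p q) :
    freeExtRel S X Y f ((tensorS S Y).lact a p) ((tensorS S Y).lact a q) := by
  obtain ⟨x, x', s, s', h, rfl, rfl⟩ := h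
  refine ⟨X.lact a x, X.lact a x', s, s', ?_, ?_, ?_⟩
  · rw [X.lact_ract, X.lact_ract]
    exact X.lact_le le_rfl h
  · exact congrArg (fun c => tensS S Y c s) (f.map_lact a x).symm
  · exact congrArg (fun c => tensS S Y c s') (f.map_lact a x').symm

/-- The free `S`-extension `F(S; X, Y)` of a morphism `f : X → Y`: the quotient of `Y ⊗ S` by the
right `S`-poset congruence induced by `freeExtRel`. -/
def freeExt (S : PomonoidUnder.{u, v} U) (X : BiPoset.{v, u, u} U S.carrier)
    (Y : BiPoset.{v, v, u} U U) (f : BiHom (X.restrict S.ι) Y) :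
    BiPoset.{v, u, u} U S.carrier :=
  BiPoset.induced (tensorS S Y) (freeExtRel S X Y f) (freeExtRel_lact S X Y f)

/-- The class of `y ⊗ s` in `F(S; X, Y)`. -/
def freeExtMk (S : PomonoidUnder.{u, v} U) (X : BiPoset.{v, u, u} U S.carrier)
    (Y : BiPoset.{v, v, u} U U) (f : BiHom (X.restrict S.ι) Y) (y : Y.carrier)
    (s : S.carrier) : (freeExt S X Y f).carrier :=
  OrdQuot.mk _ (tensS S Y y s)

/-- The map `Y → F(S; X, Y)`, sending `y` to the class of `y ⊗ 1`. -/
def freeExtUnit (S : PomonoidUnder.{u, v} U) (X : BiPoset.{v, u, u} U S.carrier)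
    (Y : BiPoset.{v, v, u} U U) (f : BiHom (X.restrict S.ι) Y) :
    BiHom Y ((freeExt S X Y f).restrict S.ι) where
  toFun y := freeExtMk S X Y f y 1
  mono h := OrdQuot.mk_le_of (Or.inl ((tensorUnit S Y).mono h))
  map_lact a y := congrArg (OrdQuot.mk _) ((tensorUnit S Y).map_lact a y)
  map_ract y a := congrArg (OrdQuot.mk _) ((tensorUnit S Y).map_ract y a)

end FreeExtension

/-! ### Direct systems and direct limits -/

/-- A direct system of `(S,T)`-posets over a quasi-ordered set `I`. -/
structure BiDirectSystem (I : Type z) [Preorder I] (S : Type u) (T : Type v) [Monoid S]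
    [PartialOrder S] [Monoid T] [PartialOrder T] where
  obj : I → BiPoset.{u, v, w} S T
  map : ∀ {i j : I}, i ≤ j → BiHom (obj i) (obj j)
  map_refl : ∀ i, map (le_refl i) = BiHom.id (obj i)
  map_trans : ∀ {i j k : I} (h : i ≤ j) (h' : j ≤ k), (map h').comp (map h) = map (h.trans h')

/-- `(X, φ)` is the direct limit of the direct system `D` in the category of `(S,T)`-posets. -/
def BiDirectSystem.IsDirectLimit {I : Type z} [Preorder I] {S : Type u} {T : Type v} [Monoid S]
    [PartialOrder S] [Monoid T] [PartialOrder T] (D : BiDirectSystem.{u, v, w, z} I S T)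
    (X : BiPoset.{u, v, x} S T) (φ : ∀ i, BiHom (D.obj i) X) : Prop :=
  (∀ (i j : I) (h : i ≤ j), (φ j).comp (D.map h) = φ i) ∧
    ∀ (Z : BiPoset.{u, v, y} S T) (ζ : ∀ i, BiHom (D.obj i) Z),
      (∀ (i j : I) (h : i ≤ j), (ζ j).comp (D.map h) = ζ i) →
        ∃! ψ : BiHom X Z, ∀ i, ψ.comp (φ i) = ζ i

/-- The direct system determined by a sequence `X 0 → X 1 → X 2 → ⋯`. -/
def BiDirectSystem.ofSeq {S : Type u} {T : Type v} [Monoid S] [PartialOrder S] [Monoid T]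
    [PartialOrder T] (X : ℕ → BiPoset.{u, v, w} S T) (k : ∀ n, BiHom (X n) (X (n + 1))) :
    BiDirectSystem.{u, v, w, 0} ℕ S T where
  obj := X
  map {i _} h := Nat.leRec (motive := fun j _ => BiHom (X i) (X j)) (BiHom.id (X i))
    (fun j _ f => (k j).comp f) h
  map_refl i := Nat.leRec_self _ _
  map_trans {i j l} h h' := by
    induction l, h' using Nat.le_induction with
    | base => rw [Nat.leRec_self]; rfl
    | succ m hm ih =>
      rw [Nat.leRec_succ _ _ (h.trans hm), Nat.leRec_succ _ _ hm, ← ih]; rfl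

/-! ### The tower of free extensions -/

section Tower

variable {U : Type v} [Monoid U] [PartialOrder U] (S₁ S₂ : PomonoidUnder.{u, v} U)

/-- `factor n` is `S₁` if `n` is odd and `S₂` if `n` is even. -/
def factor : ℕ → PomonoidUnder.{u, v} U
  | 0 => S₂
  | 1 => S₁
  | n + 2 => factor n

/-- Two consecutive terms `X = Y_{n+1}` and `Y = Y_{n+2}` of the tower, with the map between them.
-/
structure TowerStage (n : ℕ) where
  X : BiPoset.{v, u, u} U (factor S₁ S₂ (n + 1)).carrier
  Y : BiPoset.{v, u, u} U (factor S₁ S₂ (n + 2)).carrier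
  k : BiHom (X.restrict (factor S₁ S₂ (n + 1)).ι) (Y.restrict (factor S₁ S₂ (n + 2)).ι)

/-- The stages of the tower: `Y_1 = S₁`, `Y_2 = S₁ ⊗ S₂`, and `Y_{n+3} = F(S_i; Y_{n+1}, Y_{n+2})`
where `i ≡ n + 1 (mod 2)`. -/
def towerStage : (n : ℕ) → TowerStage S₁ S₂ n
  | 0 =>
    { X := S₁.biposet
      Y := tensorS S₂ (S₁.biposet.restrict S₁.ι)
      k := tensorUnit S₂ (S₁.biposet.restrict S₁.ι) }
  | n + 1 =>
    { X := (towerStage n).Y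
      Y := freeExt (factor S₁ S₂ (n + 1)) (towerStage n).X
        ((towerStage n).Y.restrict (factor S₁ S₂ (n + 2)).ι) (towerStage n).k
      k := freeExtUnit (factor S₁ S₂ (n + 1)) (towerStage n).X
        ((towerStage n).Y.restrict (factor S₁ S₂ (n + 2)).ι) (towerStage n).k }

/-- `tower n` is `Y_{n+1}`, as a `(U,U)`-poset. -/
def tower (n : ℕ) : BiPoset.{v, v, u} U U :=
  (towerStage S₁ S₂ n).X.restrict (factor S₁ S₂ (n + 1)).ι

/-- The connecting map `k_{n+1} : Y_{n+1} → Y_{n+2}`. -/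
def towerMap (n : ℕ) : BiHom (tower S₁ S₂ n) (tower S₁ S₂ (n + 1)) := (towerStage S₁ S₂ n).k

/-- The direct system `Y_1 → Y_2 → Y_3 → ⋯` of `(U,U)`-posets. -/
def towerSystem : BiDirectSystem.{v, v, u, 0} ℕ U U :=
  BiDirectSystem.ofSeq (tower S₁ S₂) (towerMap S₁ S₂)

/-- `bracket s n` is the element `[s_1, …, s_{n+1}]` of `Y_{n+1}`, where `s_i` is `s (i - 1)`
(only the first `n + 1` entries of the sequence `s` matter):
`[s_1] = s_1`, `[s_1, s_2] = s_1 ⊗ s_2`, and `[s_1, …, s_{n+3}]` is the class of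
`[s_1, …, s_{n+2}] ⊗ s_{n+3}`. -/
def bracket (s : ∀ i : ℕ, (factor S₁ S₂ (i + 1)).carrier) : (n : ℕ) → (tower S₁ S₂ n).carrier
  | 0 => s 0
  | 1 => tensS S₂ (S₁.biposet.restrict S₁.ι) (s 0) (s 1)
  | n + 2 => freeExtMk (factor S₁ S₂ (n + 1)) (towerStage S₁ S₂ n).X
      ((towerStage S₁ S₂ n).Y.restrict (factor S₁ S₂ (n + 2)).ι) (towerStage S₁ S₂ n).k
      (bracket s (n + 1)) (s (n + 2))

end Tower

/-! ### The amalgamated free product -/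

section AmalgamatedProduct

variable {U : Type v} [Monoid U] [PartialOrder U] (S₁ S₂ : PomonoidUnder.{u, v} U)

/-- The elementary steps on the free product of the monoids `S₁` and `S₂`: replacing a factor by a
larger one, and exchanging the two images of an element of `U`. -/
inductive AmalgStep :
    Monoid.Coprod S₁.carrier S₂.carrier → Monoid.Coprod S₁.carrier S₂.carrier → Prop
  | inl (p q : Monoid.Coprod S₁.carrier S₂.carrier) {a b : S₁.carrier} (h : a ≤ b) :
      AmalgStep (p * Monoid.Coprod.inl a * q) (p * Monoid.Coprod.inl b * q)
  | inr (p q : Monoid.Coprod S₁.carrier S₂.carrier) {a b : S₂.carrier} (h : a ≤ b) :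
      AmalgStep (p * Monoid.Coprod.inr a * q) (p * Monoid.Coprod.inr b * q)
  | glue₁ (p q : Monoid.Coprod S₁.carrier S₂.carrier) (c : U) :
      AmalgStep (p * Monoid.Coprod.inl (S₁.ι c) * q) (p * Monoid.Coprod.inr (S₂.ι c) * q)
  | glue₂ (p q : Monoid.Coprod S₁.carrier S₂.carrier) (c : U) :
      AmalgStep (p * Monoid.Coprod.inr (S₂.ι c) * q) (p * Monoid.Coprod.inl (S₁.ι c) * q)

theorem AmalgStep.mul_left (c : Monoid.Coprod S₁.carrier S₂.carrier)
    {a b : Monoid.Coprod S₁.carrier S₂.carrier} (h : AmalgStep S₁ S₂ a b) :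
    AmalgStep S₁ S₂ (c * a) (c * b) := by
  cases h with
  | inl p q h => simpa only [mul_assoc] using AmalgStep.inl (c * p) q h
  | inr p q h => simpa only [mul_assoc] using AmalgStep.inr (c * p) q h
  | glue₁ p q d => simpa only [mul_assoc] using AmalgStep.glue₁ (c * p) q d
  | glue₂ p q d => simpa only [mul_assoc] using AmalgStep.glue₂ (c * p) q d

theorem AmalgStep.mul_right (c : Monoid.Coprod S₁.carrier S₂.carrier)
    {a b : Monoid.Coprod S₁.carrier S₂.carrier} (h : AmalgStep S₁ S₂ a b) :
    AmalgStep S₁ S₂ (a * c) (b * c) := by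
  cases h with
  | inl p q h => simpa only [mul_assoc] using AmalgStep.inl p (q * c) h
  | inr p q h => simpa only [mul_assoc] using AmalgStep.inr p (q * c) h
  | glue₁ p q d => simpa only [mul_assoc] using AmalgStep.glue₁ p (q * c) d
  | glue₂ p q d => simpa only [mul_assoc] using AmalgStep.glue₂ p (q * c) d

/-- The amalgamated free product `S₁ *_U S₂` in the category of pomonoids. -/
def AmalgProd : Type u := OrdQuot (AmalgStep S₁ S₂)

namespace AmalgProd

instance : PartialOrder (AmalgProd S₁ S₂) :=
  inferInstanceAs (PartialOrder (OrdQuot (AmalgStep S₁ S₂)))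

/-- The class of an element of the free product of monoids. -/
def mk (a : Monoid.Coprod S₁.carrier S₂.carrier) : AmalgProd S₁ S₂ := OrdQuot.mk _ a

theorem gen_mul {a a' b b' : Monoid.Coprod S₁.carrier S₂.carrier}
    (h : Relation.ReflTransGen (AmalgStep S₁ S₂) a a')
    (k : Relation.ReflTransGen (AmalgStep S₁ S₂) b b') :
    Relation.ReflTransGen (AmalgStep S₁ S₂) (a * b) (a' * b') :=
  (h.lift (· * b) fun _ _ => AmalgStep.mul_right S₁ S₂ b).trans
    (k.lift (a' * ·) fun _ _ => AmalgStep.mul_left S₁ S₂ a')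

/-- The multiplication induced from the free product of monoids. -/
def mul : AmalgProd S₁ S₂ → AmalgProd S₁ S₂ → AmalgProd S₁ S₂ :=
  Quotient.map₂ (fun a b => a * b) (fun _ _ h _ _ k =>
    ⟨gen_mul S₁ S₂ h.1 k.1, gen_mul S₁ S₂ h.2 k.2⟩)

instance : Monoid (AmalgProd S₁ S₂) where
  mul := mul S₁ S₂
  one := mk S₁ S₂ 1
  mul_assoc := by
    rintro ⟨a⟩ ⟨b⟩ ⟨c⟩
    exact congrArg (mk S₁ S₂) (mul_assoc a b c)
  one_mul := by
    rintro ⟨a⟩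
    exact congrArg (mk S₁ S₂) (one_mul a)
  mul_one := by
    rintro ⟨a⟩
    exact congrArg (mk S₁ S₂) (mul_one a)

theorem mul_le {a a' b b' : AmalgProd S₁ S₂} (h : a ≤ a') (k : b ≤ b') :
    a * b ≤ a' * b' := by
  induction a using Quotient.inductionOn
  induction a' using Quotient.inductionOn
  induction b using Quotient.inductionOn
  induction b' using Quotient.inductionOn
  exact gen_mul S₁ S₂ h k

/-- The canonical morphism `S₁ → S₁ *_U S₂`. -/
def inl : S₁.carrier →*o AmalgProd S₁ S₂ where
  toFun a := mk S₁ S₂ (Monoid.Coprod.inl a)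
  map_one' := congrArg (mk S₁ S₂) (map_one _)
  map_mul' a b := congrArg (mk S₁ S₂) (map_mul _ a b)
  monotone' a b h := OrdQuot.mk_le_of (by simpa using AmalgStep.inl (S₁ := S₁) (S₂ := S₂) 1 1 h)

/-- The canonical morphism `S₂ → S₁ *_U S₂`. -/
def inr : S₂.carrier →*o AmalgProd S₁ S₂ where
  toFun a := mk S₁ S₂ (Monoid.Coprod.inr a)
  map_one' := congrArg (mk S₁ S₂) (map_one _)
  map_mul' a b := congrArg (mk S₁ S₂) (map_mul _ a b)
  monotone' a b h := OrdQuot.mk_le_of (by simpa using AmalgStep.inr (S₁ := S₁) (S₂ := S₂) 1 1 h)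

/-- The two composites `U → S_i → S₁ *_U S₂` agree. -/
theorem inl_ι (c : U) : inl S₁ S₂ (S₁.ι c) = inr S₁ S₂ (S₂.ι c) :=
  le_antisymm
    (OrdQuot.mk_le_of (by simpa using AmalgStep.glue₁ (S₁ := S₁) (S₂ := S₂) 1 1 c))
    (OrdQuot.mk_le_of (by simpa using AmalgStep.glue₂ (S₁ := S₁) (S₂ := S₂) 1 1 c))

/-- `S₁ *_U S₂` as a `(U,U)`-poset: `U` acts on both sides by multiplication by its image in
`S₁ *_U S₂`. -/
def biposet : BiPoset.{v, v, u} U U where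
  carrier := AmalgProd S₁ S₂
  nonempty := ⟨1⟩
  lact c a := inl S₁ S₂ (S₁.ι c) * a
  ract a c := a * inl S₁ S₂ (S₁.ι c)
  one_lact a := by rw [map_one, map_one, one_mul]
  mul_lact c d a := by rw [map_mul, map_mul, mul_assoc]
  ract_one a := by rw [map_one, map_one, mul_one]
  ract_mul a c d := by rw [map_mul, map_mul, mul_assoc]
  lact_ract c a d := mul_assoc _ a _
  lact_le h k := mul_le S₁ S₂ ((inl S₁ S₂).monotone' (S₁.ι.monotone' h)) k
  ract_le h k := mul_le S₁ S₂ h ((inl S₁ S₂).monotone' (S₁.ι.monotone' k))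

/-- The canonical map into `S₁ *_U S₂` of the pomonoid (`S₁` or `S₂`) with number `n`. -/
def letter : (n : ℕ) → (factor S₁ S₂ n).carrier → AmalgProd S₁ S₂
  | 0 => inr S₁ S₂
  | 1 => inl S₁ S₂
  | n + 2 => letter n

/-- `word s n` is the element `(s_1, …, s_{n+1}) = s_1 s_2 ⋯ s_{n+1}` of `S₁ *_U S₂`, where `s_i`
is `s (i - 1)`. -/
def word (s : ∀ i : ℕ, (factor S₁ S₂ (i + 1)).carrier) : ℕ → AmalgProd S₁ S₂
  | 0 => letter S₁ S₂ 1 (s 0)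
  | n + 1 => word s n * letter S₁ S₂ (n + 2) (s (n + 1))

end AmalgProd

end AmalgamatedProduct

/-!
The amalgamated free product `P = S₁ *_U S₂` acts on the right of the colimit `L` of the tower, and
`P` is recovered from `L` as the orbit of the class of `1`.

The maps `φ_n : Y_n → P` come from the universal properties of the tensor product and of the induced
quotient: `y ⊗ t ↦ φ(y) t` is monotone and balanced, and it respects the pairs
`(k(y) ⊗ s, k(y') ⊗ s')` with `ys ≤ y's'` because `φ(k(y)) s = φ(ys)` (`TowerEval.exists_succ`).
They are unique since every element of `Y_n` is a bracket (`bracket_surjective`).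

For the limit property, let `L` be the order-theoretic colimit of the `Y_n` (`TowerColim`). The
relations imposed on `Y_{n+3}` say exactly that the composite `Y_{n+1} → Y_{n+3}` is equivariant for
the factor acting on both of them (`towerMap_towerMap_ract`), so that `S₁` and `S₂` both act
monotonically on the right of `L`, and the two actions agree on `U`. Hence the free product of the
monoids acts, the elementary steps of `P` being respected (`TowerColim.act_le_of_gen`). The class of
`y ∈ Y_n` is `[1] · φ_n(y)` (`TowerColim.exists_act_base`), so `φ_m(y) ≤ φ_n(y')` implies that the
class of `y` lies below that of `y'` in `L`, hence that `ζ_m(y) ≤ ζ_n(y')` for every cocone `ζ`.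
As the `φ_n` are jointly surjective (`TowerEval.exists_eq`), `φ_n(y) ↦ ζ_n(y)` is the required
morphism.
-/

section TowerProofs

variable {U : Type v} [Monoid U] [PartialOrder U] {S₁ S₂ : PomonoidUnder.{u, v} U}

/-! ### Elements of the tower -/

/-- The right action on `Y_{n+1}` of the whole pomonoid `S_i` with `i ≡ n + 1 (mod 2)`, of which
`tower` only retains the restriction to `U`. -/
def towerRact (n : ℕ) (y : (tower S₁ S₂ n).carrier) (t : (factor S₁ S₂ (n + 1)).carrier) :
    (tower S₁ S₂ n).carrier :=
  (towerStage S₁ S₂ n).X.ract y t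

/-- The class of `y ⊗ t` in `Y_{n+2}`, for `y ∈ Y_{n+1}`. -/
def towerSnoc : (n : ℕ) → (tower S₁ S₂ n).carrier → (factor S₁ S₂ (n + 2)).carrier →
    (tower S₁ S₂ (n + 1)).carrier
  | 0 => tensS S₂ (S₁.biposet.restrict S₁.ι)
  | n + 1 => freeExtMk (factor S₁ S₂ (n + 1)) (towerStage S₁ S₂ n).X
      ((towerStage S₁ S₂ n).Y.restrict (factor S₁ S₂ (n + 2)).ι) (towerStage S₁ S₂ n).k

theorem towerRact_le {n : ℕ} {y y' : (tower S₁ S₂ n).carrier}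
    {t t' : (factor S₁ S₂ (n + 1)).carrier} (h : y ≤ y') (k : t ≤ t') :
    towerRact n y t ≤ towerRact n y' t' :=
  (towerStage S₁ S₂ n).X.ract_le h k

theorem towerRact_one (n : ℕ) (y : (tower S₁ S₂ n).carrier) : towerRact n y 1 = y :=
  (towerStage S₁ S₂ n).X.ract_one y

theorem towerRact_mul (n : ℕ) (y : (tower S₁ S₂ n).carrier)
    (t t' : (factor S₁ S₂ (n + 1)).carrier) :
    towerRact n y (t * t') = towerRact n (towerRact n y t) t' :=
  (towerStage S₁ S₂ n).X.ract_mul y t t'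

theorem towerSnoc_le {n : ℕ} {y y' : (tower S₁ S₂ n).carrier}
    {t t' : (factor S₁ S₂ (n + 2)).carrier} (h : y ≤ y') (k : t ≤ t') :
    towerSnoc n y t ≤ towerSnoc n y' t' := by
  cases n with
  | zero => exact BiPoset.tmk_le _ _ h k
  | succ n => exact OrdQuot.mk_le_of (Or.inl (BiPoset.tmk_le _ _ h k))

theorem towerSnoc_ract (n : ℕ) (y : (tower S₁ S₂ n).carrier) (c : U)
    (t : (factor S₁ S₂ (n + 2)).carrier) :
    towerSnoc n ((tower S₁ S₂ n).ract y c) t = towerSnoc n y ((factor S₁ S₂ (n + 2)).ι c * t) := by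
  cases n with
  | zero => exact BiPoset.tmk_balanced (tower S₁ S₂ 0) S₂.biposet y c t
  | succ n =>
    exact congrArg (OrdQuot.mk _)
      (BiPoset.tmk_balanced (tower S₁ S₂ (n + 1)) (factor S₁ S₂ (n + 1)).biposet y c t)

theorem towerRact_towerSnoc (n : ℕ) (y : (tower S₁ S₂ n).carrier)
    (t t' : (factor S₁ S₂ (n + 2)).carrier) :
    towerRact (n + 1) (towerSnoc n y t) t' = towerSnoc n y (t * t') := by
  cases n <;> rfl

theorem lact_towerSnoc (n : ℕ) (c : U) (y : (tower S₁ S₂ n).carrier)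
    (t : (factor S₁ S₂ (n + 2)).carrier) :
    (tower S₁ S₂ (n + 1)).lact c (towerSnoc n y t) =
      towerSnoc n ((tower S₁ S₂ n).lact c y) t := by
  cases n <;> rfl

theorem towerMap_eq_towerSnoc (n : ℕ) (y : (tower S₁ S₂ n).carrier) :
    (towerMap S₁ S₂ n).toFun y = towerSnoc n y 1 := by
  cases n <;> rfl

theorem towerRact_towerMap (n : ℕ) (y : (tower S₁ S₂ n).carrier)
    (t : (factor S₁ S₂ (n + 2)).carrier) :
    towerRact (n + 1) ((towerMap S₁ S₂ n).toFun y) t = towerSnoc n y t := by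
  rw [towerMap_eq_towerSnoc, towerRact_towerSnoc, one_mul]

/-- The generating pairs of the congruence which defines `Y_{n+3}`. -/
theorem towerSnoc_towerMap_le {n : ℕ} {y y' : (tower S₁ S₂ n).carrier}
    {t t' : (factor S₁ S₂ (n + 1)).carrier} (h : towerRact n y t ≤ towerRact n y' t') :
    towerSnoc (n + 1) ((towerMap S₁ S₂ n).toFun y) t ≤
      towerSnoc (n + 1) ((towerMap S₁ S₂ n).toFun y') t' := by
  refine OrdQuot.mk_le_of (Or.inr ⟨_, _, 1, ⟨y, y', t, t', h, rfl, rfl⟩, ?_, ?_⟩)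
  · exact (BiPoset.ract_one _ _).symm
  · exact (BiPoset.ract_one _ _).symm

/-- The composite `Y_{n+1} → Y_{n+3}` is equivariant for the pomonoid `S_i`, `i ≡ n + 1 (mod 2)`,
which acts on both sides. -/
theorem towerMap_towerMap_ract (n : ℕ) (y : (tower S₁ S₂ n).carrier)
    (t : (factor S₁ S₂ (n + 1)).carrier) :
    (towerMap S₁ S₂ (n + 1)).toFun ((towerMap S₁ S₂ n).toFun (towerRact n y t)) =
      towerSnoc (n + 1) ((towerMap S₁ S₂ n).toFun y) t := by
  rw [towerMap_eq_towerSnoc (n + 1)]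
  have h : towerRact n (towerRact n y t) 1 = towerRact n y t := towerRact_one _ _
  exact le_antisymm (towerSnoc_towerMap_le h.le) (towerSnoc_towerMap_le h.ge)

theorem towerSnoc_surjective (n : ℕ) (z : (tower S₁ S₂ (n + 1)).carrier) :
    ∃ y t, towerSnoc n y t = z := by
  cases n with
  | zero =>
    induction z using OrdQuot.ind with
    | h p => exact ⟨p.1, p.2, rfl⟩
  | succ n =>
    induction z using OrdQuot.ind with
    | h p =>
      induction p using OrdQuot.ind with
      | h p => exact ⟨p.1, p.2, rfl⟩

theorem bracket_succ (s : ∀ i : ℕ, (factor S₁ S₂ (i + 1)).carrier) (n : ℕ) :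
    bracket S₁ S₂ s (n + 1) = towerSnoc n (bracket S₁ S₂ s n) (s (n + 1)) := by
  cases n <;> rfl

theorem bracket_congr {s s' : ∀ i : ℕ, (factor S₁ S₂ (i + 1)).carrier} {n : ℕ}
    (h : ∀ i ≤ n, s i = s' i) : bracket S₁ S₂ s n = bracket S₁ S₂ s' n := by
  induction n with
  | zero => exact h 0 le_rfl
  | succ n ih =>
    rw [bracket_succ, bracket_succ, ih fun i hi => h i (hi.trans n.le_succ), h _ le_rfl]

theorem bracket_surjective (n : ℕ) (y : (tower S₁ S₂ n).carrier) :
    ∃ s, bracket S₁ S₂ s n = y := by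
  induction n with
  | zero =>
    exact ⟨Function.update (fun _ => 1) 0 y,
      Function.update_self (β := fun i : ℕ => (factor S₁ S₂ (i + 1)).carrier) 0 y _⟩
  | succ n ih =>
    obtain ⟨y, t, rfl⟩ := towerSnoc_surjective n y
    obtain ⟨s, rfl⟩ := ih y
    refine ⟨Function.update s (n + 1) t, ?_⟩
    rw [bracket_succ, Function.update_self]
    congr 1
    exact bracket_congr fun i hi => Function.update_of_ne (by omega) _ _

/-! ### The morphisms to the amalgamated free product -/

/-- The universal property of `Y_2 = S₁ ⊗ S₂`. -/
theorem exists_lift_zero {C : Type u} [PartialOrder C]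
    (g : (tower S₁ S₂ 0).carrier → (factor S₁ S₂ 2).carrier → C)
    (mono : ∀ {y y' t t'}, y ≤ y' → t ≤ t' → g y t ≤ g y' t')
    (bal : ∀ y c t, g ((tower S₁ S₂ 0).ract y c) t = g y ((factor S₁ S₂ 2).ι c * t)) :
    ∃ h : (tower S₁ S₂ 1).carrier → C, Monotone h ∧ ∀ y t, h (towerSnoc 0 y t) = g y t := by
  refine ⟨OrdQuot.lift (fun p => g p.1 p.2) ?_, fun _ _ => OrdQuot.lift_mono _ _,
    fun _ _ => rfl⟩
  rintro p q (h | ⟨a, c, b, rfl, rfl⟩ | ⟨a, c, b, rfl, rfl⟩)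
  · exact mono h.1 h.2
  · exact (bal a c b).le
  · exact (bal a c b).ge

/-- The universal property of `Y_{n+3}` as a poset: a monotone balanced map on `Y_{n+2} × S_i` which
is monotone along the generating pairs factors through it. No equivariance is needed. -/
theorem exists_lift_succ (n : ℕ) {C : Type u} [PartialOrder C]
    (g : (tower S₁ S₂ (n + 1)).carrier → (factor S₁ S₂ (n + 1)).carrier → C)
    (mono : ∀ {y y' t t'}, y ≤ y' → t ≤ t' → g y t ≤ g y' t')
    (bal : ∀ y c t, g ((tower S₁ S₂ (n + 1)).ract y c) t = g y ((factor S₁ S₂ (n + 1)).ι c * t))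
    (hV : ∀ {y y' t t'}, towerRact n y t ≤ towerRact n y' t' →
      g ((towerMap S₁ S₂ n).toFun y) t ≤ g ((towerMap S₁ S₂ n).toFun y') t') :
    ∃ h : (tower S₁ S₂ (n + 2)).carrier → C,
      Monotone h ∧ ∀ y t, h (towerSnoc (n + 1) y t) = g y t := by
  have hg : ∀ p q, BiPoset.tensorRel (tower S₁ S₂ (n + 1)) (factor S₁ S₂ (n + 1)).biposet p q →
      g p.1 p.2 ≤ g q.1 q.2 := by
    rintro p q (h | ⟨a, c, b, rfl, rfl⟩ | ⟨a, c, b, rfl, rfl⟩)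
    · exact mono h.1 h.2
    · exact (bal a c b).le
    · exact (bal a c b).ge
  refine ⟨OrdQuot.lift (OrdQuot.lift (fun p => g p.1 p.2) hg) ?_,
    fun _ _ => OrdQuot.lift_mono _ _, fun _ _ => rfl⟩
  rintro p q (h | ⟨_, _, t, ⟨x, x', s, s', h, rfl, rfl⟩, rfl, rfl⟩)
  · exact OrdQuot.lift_mono _ _ h
  · -- the generating relation is stable under the right action
    refine hV (t := s * t) (t' := s' * t) ?_
    exact (towerRact_mul n x s t).le.trans
      ((towerRact_le (n := n) h le_rfl).trans (towerRact_mul n x' s' t).ge)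

namespace AmalgProd

theorem letter_one (n : ℕ) : letter S₁ S₂ n 1 = 1 := by
  induction n using Nat.twoStepInduction with
  | zero => exact map_one (inr S₁ S₂)
  | one => exact map_one (inl S₁ S₂)
  | more n h _ => exact h

theorem letter_mul (n : ℕ) (a b : (factor S₁ S₂ n).carrier) :
    letter S₁ S₂ n (a * b) = letter S₁ S₂ n a * letter S₁ S₂ n b := by
  induction n using Nat.twoStepInduction with
  | zero => exact map_mul (inr S₁ S₂) a b
  | one => exact map_mul (inl S₁ S₂) a b
  | more n h _ => exact h a b

theorem letter_le (n : ℕ) {a b : (factor S₁ S₂ n).carrier} (h : a ≤ b) :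
    letter S₁ S₂ n a ≤ letter S₁ S₂ n b := by
  induction n using Nat.twoStepInduction with
  | zero => exact (inr S₁ S₂).monotone' h
  | one => exact (inl S₁ S₂).monotone' h
  | more n ih _ => exact ih h

theorem letter_ι (n : ℕ) (c : U) :
    letter S₁ S₂ n ((factor S₁ S₂ n).ι c) = inl S₁ S₂ (S₁.ι c) := by
  induction n using Nat.twoStepInduction with
  | zero => exact (inl_ι S₁ S₂ c).symm
  | one => rfl
  | more n h _ => exact h

end AmalgProd

open AmalgProd

/-- `f : Y_{n+1} → S₁ *_U S₂` is a morphism, equivariant for the whole pomonoid acting on the right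
of `Y_{n+1}`, which sends each bracket to the corresponding word. -/
structure TowerEval (n : ℕ) (f : (tower S₁ S₂ n).carrier → AmalgProd S₁ S₂) : Prop where
  mono : Monotone f
  map_lact : ∀ c y, f ((tower S₁ S₂ n).lact c y) = inl S₁ S₂ (S₁.ι c) * f y
  map_ract : ∀ y t, f (towerRact n y t) = f y * letter S₁ S₂ (n + 1) t
  map_bracket : ∀ s, f (bracket S₁ S₂ s n) = word S₁ S₂ s n

namespace TowerEval

theorem of_snoc {n : ℕ} {f : (tower S₁ S₂ n).carrier → AmalgProd S₁ S₂}
    {g : (tower S₁ S₂ (n + 1)).carrier → AmalgProd S₁ S₂} (hf : TowerEval n f) (hg : Monotone g)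
    (hgf : ∀ y t, g (towerSnoc n y t) = f y * letter S₁ S₂ (n + 2) t) : TowerEval (n + 1) g where
  mono := hg
  map_lact c z := by
    obtain ⟨y, t, rfl⟩ := towerSnoc_surjective n z
    rw [lact_towerSnoc, hgf, hgf, hf.map_lact, mul_assoc]
  map_ract z t' := by
    obtain ⟨y, t, rfl⟩ := towerSnoc_surjective n z
    rw [towerRact_towerSnoc, hgf, hgf, letter_mul, mul_assoc]
  map_bracket s := by
    rw [bracket_succ, hgf, hf.map_bracket]
    rfl

theorem mul_letter_le {n m : ℕ} {f : (tower S₁ S₂ n).carrier → AmalgProd S₁ S₂}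
    (hf : TowerEval n f) {y y' : (tower S₁ S₂ n).carrier} {t t' : (factor S₁ S₂ m).carrier}
    (h : y ≤ y') (k : t ≤ t') : f y * letter S₁ S₂ m t ≤ f y' * letter S₁ S₂ m t' :=
  AmalgProd.mul_le S₁ S₂ (hf.mono h) (letter_le m k)

theorem ract_mul_letter {n m : ℕ} {f : (tower S₁ S₂ n).carrier → AmalgProd S₁ S₂}
    (hf : TowerEval n f) (y : (tower S₁ S₂ n).carrier) (c : U) (t : (factor S₁ S₂ m).carrier) :
    f ((tower S₁ S₂ n).ract y c) * letter S₁ S₂ m t =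
      f y * letter S₁ S₂ m ((factor S₁ S₂ m).ι c * t) := by
  have h : f ((tower S₁ S₂ n).ract y c) = _ := hf.map_ract y ((factor S₁ S₂ (n + 1)).ι c)
  rw [h, letter_mul, letter_ι, letter_ι, mul_assoc]

/-- Two consecutive evaluations, constructed together: the one on `Y_{n+3}` respects the relations
that define `Y_{n+3}` because those on `Y_{n+1}` and `Y_{n+2}` are compatible. -/
theorem exists_succ (n : ℕ) : ∃ (f : (tower S₁ S₂ n).carrier → AmalgProd S₁ S₂)
    (g : (tower S₁ S₂ (n + 1)).carrier → AmalgProd S₁ S₂), TowerEval n f ∧ TowerEval (n + 1) g ∧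
      ∀ y t, g (towerSnoc n y t) = f y * letter S₁ S₂ (n + 2) t := by
  induction n with
  | zero =>
    have hf : TowerEval (S₁ := S₁) (S₂ := S₂) 0 (inl S₁ S₂) :=
      { mono := (inl S₁ S₂).monotone'
        map_lact := fun c y => map_mul (inl S₁ S₂) (S₁.ι c) y
        map_ract := map_mul (inl S₁ S₂)
        map_bracket := fun _ => rfl }
    obtain ⟨g, hg, hgf⟩ := exists_lift_zero (fun y t => inl S₁ S₂ y * letter S₁ S₂ 2 t)
      hf.mul_letter_le hf.ract_mul_letter
    exact ⟨_, g, hf, hf.of_snoc hg hgf, hgf⟩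
  | succ n ih =>
    obtain ⟨f, g, hf, hg, hgf⟩ := ih
    obtain ⟨h, hh, hhg⟩ := exists_lift_succ n (fun y t => g y * letter S₁ S₂ (n + 1) t)
      hg.mul_letter_le hg.ract_mul_letter (by
        intro y y' t t' le
        simpa only [towerMap_eq_towerSnoc, hgf, letter_one, mul_one, hf.map_ract] using hf.mono le)
    exact ⟨g, h, hg, hg.of_snoc hh hhg, hhg⟩

variable {φ : ∀ n : ℕ, (tower S₁ S₂ n).carrier → AmalgProd S₁ S₂}

theorem map_snoc (hφ : ∀ n, TowerEval n (φ n)) (n : ℕ) (y : (tower S₁ S₂ n).carrier)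
    (t : (factor S₁ S₂ (n + 2)).carrier) :
    φ (n + 1) (towerSnoc n y t) = φ n y * letter S₁ S₂ (n + 2) t := by
  -- read off the value at a bracket with last entry `t`
  obtain ⟨s, rfl⟩ := bracket_surjective n y
  have h : bracket S₁ S₂ (Function.update s (n + 1) t) n = bracket S₁ S₂ s n :=
    bracket_congr fun i hi => Function.update_of_ne (by omega) _ _
  have key := (hφ (n + 1)).map_bracket (Function.update s (n + 1) t)
  rw [bracket_succ, Function.update_self, h] at key
  rw [key, ← h, (hφ n).map_bracket]
  exact congrArg (fun t => _ * letter S₁ S₂ (n + 2) t) (Function.update_self (n + 1) t s)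

theorem map_towerMap (hφ : ∀ n, TowerEval n (φ n)) (n : ℕ) (y : (tower S₁ S₂ n).carrier) :
    φ (n + 1) ((towerMap S₁ S₂ n).toFun y) = φ n y := by
  rw [towerMap_eq_towerSnoc, map_snoc hφ, letter_one, mul_one]

end TowerEval

/-! ### Letters seen from a stage of the tower -/

/-- An element of `S₁` or `S₂`, regarded as an element of `factor n` or `factor (n + 1)`. This
replaces case distinctions on the parity of `n`, and relies on `factor (n + 2)` being `factor n` by
definition. -/
def place : (n : ℕ) → S₁.carrier ⊕ S₂.carrier →
    (factor S₁ S₂ n).carrier ⊕ (factor S₁ S₂ (n + 1)).carrier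
  | 0, x => x.swap
  | n + 1, x => (place n x).swap

theorem place_surjective (n : ℕ) : Function.Surjective (place (S₁ := S₁) (S₂ := S₂) n) := by
  induction n with
  | zero => exact Sum.swap_rightInverse.surjective
  | succ n ih => exact Sum.swap_rightInverse.surjective.comp ih

/-- The image of a letter in the free product of monoids. -/
def coprodOf (x : S₁.carrier ⊕ S₂.carrier) : Monoid.Coprod S₁.carrier S₂.carrier :=
  x.elim Monoid.Coprod.inl Monoid.Coprod.inr

theorem letter_place (n : ℕ) (x : S₁.carrier ⊕ S₂.carrier) :
    (place n x).elim (letter S₁ S₂ n) (letter S₁ S₂ (n + 1)) = AmalgProd.mk S₁ S₂ (coprodOf x) := by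
  induction n with
  | zero => cases x <;> rfl
  | succ n ih =>
    rw [← ih]
    change Sum.elim _ (letter S₁ S₂ n) (place n x).swap = _
    cases place n x <;> rfl

/-- At stage `n`, the pomonoid `S`, whose elements are regarded as letters through `j`, maps to one
of `factor n` and `factor (n + 1)` by a pomonoid morphism under `U`, always to the same one. -/
def IsPlacedAt (S : PomonoidUnder.{u, v} U) (j : S.carrier → S₁.carrier ⊕ S₂.carrier) (n : ℕ) :
    Prop :=
  (∃ f : S.carrier →*o (factor S₁ S₂ n).carrier,
    (∀ c, f (S.ι c) = (factor S₁ S₂ n).ι c) ∧ ∀ a, place n (j a) = Sum.inl (f a)) ∨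
  (∃ f : S.carrier →*o (factor S₁ S₂ (n + 1)).carrier,
    (∀ c, f (S.ι c) = (factor S₁ S₂ (n + 1)).ι c) ∧ ∀ a, place n (j a) = Sum.inr (f a))

theorem IsPlacedAt.succ {S : PomonoidUnder.{u, v} U} {j : S.carrier → S₁.carrier ⊕ S₂.carrier}
    {n : ℕ} (h : IsPlacedAt S j n) : IsPlacedAt S j (n + 1) := by
  rcases h with ⟨f, hf, hj⟩ | ⟨f, hf, hj⟩
  · exact Or.inr ⟨f, hf, fun a => congrArg Sum.swap (hj a)⟩
  · exact Or.inl ⟨f, hf, fun a => congrArg Sum.swap (hj a)⟩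

theorem isPlacedAt_inl (n : ℕ) : IsPlacedAt (S₁ := S₁) (S₂ := S₂) S₁ Sum.inl n := by
  induction n with
  | zero => exact Or.inr ⟨OrderMonoidHom.id _, fun _ => rfl, fun _ => rfl⟩
  | succ n ih => exact ih.succ

theorem isPlacedAt_inr (n : ℕ) : IsPlacedAt (S₁ := S₁) (S₂ := S₂) S₂ Sum.inr n := by
  induction n with
  | zero => exact Or.inl ⟨OrderMonoidHom.id _, fun _ => rfl, fun _ => rfl⟩
  | succ n ih => exact ih.succ

/-! ### The colimit of the tower and the action of the factors on it -/

variable (S₁ S₂) in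
/-- The relations defining the colimit of the tower: the orders of its terms, and the
identification of each element with its image in the next term. -/
inductive TowerRel : (Σ n, (tower S₁ S₂ n).carrier) → (Σ n, (tower S₁ S₂ n).carrier) → Prop
  | le (n : ℕ) {y y' : (tower S₁ S₂ n).carrier} (h : y ≤ y') : TowerRel ⟨n, y⟩ ⟨n, y'⟩
  | up (n : ℕ) (y : (tower S₁ S₂ n).carrier) :
      TowerRel ⟨n, y⟩ ⟨n + 1, (towerMap S₁ S₂ n).toFun y⟩
  | down (n : ℕ) (y : (tower S₁ S₂ n).carrier) :
      TowerRel ⟨n + 1, (towerMap S₁ S₂ n).toFun y⟩ ⟨n, y⟩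

variable (S₁ S₂) in
/-- The colimit of the tower in the category of posets. -/
abbrev TowerColim : Type u := OrdQuot (TowerRel S₁ S₂)

namespace TowerColim

/-- The class of an element of `Y_{n+1}`. -/
def of (n : ℕ) (y : (tower S₁ S₂ n).carrier) : TowerColim S₁ S₂ := OrdQuot.mk _ ⟨n, y⟩

theorem of_le {n : ℕ} {y y' : (tower S₁ S₂ n).carrier} (h : y ≤ y') : of n y ≤ of n y' :=
  OrdQuot.mk_le_of (TowerRel.le n h)

theorem of_towerMap (n : ℕ) (y : (tower S₁ S₂ n).carrier) :
    of (n + 1) ((towerMap S₁ S₂ n).toFun y) = of n y :=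
  le_antisymm (OrdQuot.mk_le_of (TowerRel.down n y)) (OrdQuot.mk_le_of (TowerRel.up n y))

theorem of_snoc_one (n : ℕ) (y : (tower S₁ S₂ n).carrier) :
    of (n + 1) (towerSnoc n y 1) = of n y := by
  rw [← towerMap_eq_towerSnoc, of_towerMap]

theorem ind {p : TowerColim S₁ S₂ → Prop} (h : ∀ n y, p (of n y)) (l : TowerColim S₁ S₂) : p l :=
  OrdQuot.ind (fun a => h a.1 a.2) l

/-- The action of a letter on an element of `Y_{n+1}`: through the right action of `factor (n + 1)`
if the letter lies there, and by `y ↦ y ⊗ t ∈ Y_{n+2}` otherwise. -/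
def letterActAux (x : S₁.carrier ⊕ S₂.carrier) (a : Σ n, (tower S₁ S₂ n).carrier) :
    TowerColim S₁ S₂ :=
  (place (a.1 + 1) x).elim (fun t => of a.1 (towerRact a.1 a.2 t))
    (fun t => of (a.1 + 1) (towerSnoc a.1 a.2 t))

theorem letterActAux_towerMap (x : S₁.carrier ⊕ S₂.carrier) (n : ℕ)
    (y : (tower S₁ S₂ n).carrier) :
    letterActAux x ⟨n + 1, (towerMap S₁ S₂ n).toFun y⟩ = letterActAux x ⟨n, y⟩ := by
  change Sum.elim (fun t => of (n + 1) (towerRact (n + 1) ((towerMap S₁ S₂ n).toFun y) t))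
      (fun t => of (n + 2) (towerSnoc (n + 1) ((towerMap S₁ S₂ n).toFun y) t))
      (place (n + 1) x).swap =
    (place (n + 1) x).elim (fun t => of n (towerRact n y t)) (fun t => of (n + 1) (towerSnoc n y t))
  rcases place (n + 1) x with t | t
  · change of (n + 2) (towerSnoc (n + 1) ((towerMap S₁ S₂ n).toFun y) t) = of n (towerRact n y t)
    rw [← towerMap_towerMap_ract, of_towerMap, of_towerMap]
  · change of (n + 1) (towerRact (n + 1) ((towerMap S₁ S₂ n).toFun y) t) =
      of (n + 1) (towerSnoc n y t)
    rw [towerRact_towerMap]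

theorem letterActAux_le (x : S₁.carrier ⊕ S₂.carrier) (a b : Σ n, (tower S₁ S₂ n).carrier)
    (h : TowerRel S₁ S₂ a b) : letterActAux x a ≤ letterActAux x b := by
  cases h with
  | le n h =>
    unfold letterActAux
    cases place (n + 1) x with
    | inl t => exact of_le (towerRact_le h le_rfl)
    | inr t => exact of_le (towerSnoc_le h le_rfl)
  | up n y => exact (letterActAux_towerMap x n y).ge
  | down n y => exact (letterActAux_towerMap x n y).le

/-- The right action of a letter on the colimit of the tower. -/
def letterAct (x : S₁.carrier ⊕ S₂.carrier) : TowerColim S₁ S₂ → TowerColim S₁ S₂ :=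
  OrdQuot.lift (letterActAux x) (letterActAux_le x)

theorem letterAct_mono (x : S₁.carrier ⊕ S₂.carrier) : Monotone (letterAct x) :=
  fun _ _ => OrdQuot.lift_mono _ _

theorem letterAct_of_inl {n : ℕ} {x : S₁.carrier ⊕ S₂.carrier}
    {t : (factor S₁ S₂ (n + 1)).carrier} (h : place (n + 1) x = Sum.inl t)
    (y : (tower S₁ S₂ n).carrier) : letterAct x (of n y) = of n (towerRact n y t) := by
  change letterActAux x ⟨n, y⟩ = _
  simp only [letterActAux, h, Sum.elim_inl]

theorem letterAct_of_inr {n : ℕ} {x : S₁.carrier ⊕ S₂.carrier}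
    {t : (factor S₁ S₂ (n + 2)).carrier} (h : place (n + 1) x = Sum.inr t)
    (y : (tower S₁ S₂ n).carrier) : letterAct x (of n y) = of (n + 1) (towerSnoc n y t) := by
  change letterActAux x ⟨n, y⟩ = _
  simp only [letterActAux, h, Sum.elim_inr]

section FactorAction

variable {S : PomonoidUnder.{u, v} U} {j : S.carrier → S₁.carrier ⊕ S₂.carrier}

theorem letterAct_one (hj : ∀ n, IsPlacedAt S j n) (l : TowerColim S₁ S₂) :
    letterAct (j 1) l = l := by
  induction l using ind with
  | h n y =>
    rcases hj (n + 1) with ⟨f, -, h⟩ | ⟨f, -, h⟩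
    · rw [letterAct_of_inl (h 1), map_one, towerRact_one]
    · rw [letterAct_of_inr (h 1), map_one, of_snoc_one]

theorem letterAct_mul (hj : ∀ n, IsPlacedAt S j n) (a b : S.carrier) (l : TowerColim S₁ S₂) :
    letterAct (j (a * b)) l = letterAct (j b) (letterAct (j a) l) := by
  induction l using ind with
  | h n y =>
    rcases hj (n + 1) with ⟨f, -, h⟩ | ⟨f, -, h⟩
    · rw [letterAct_of_inl (h _), letterAct_of_inl (h _), letterAct_of_inl (h _), map_mul,
        towerRact_mul]
    · have hb : place (n + 2) (j b) = Sum.inl (f b) := congrArg Sum.swap (h b)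
      rw [letterAct_of_inr (h _), letterAct_of_inr (h _), letterAct_of_inl hb, map_mul,
        towerRact_towerSnoc]

theorem letterAct_le (hj : ∀ n, IsPlacedAt S j n) {a b : S.carrier} (hab : a ≤ b)
    (l : TowerColim S₁ S₂) : letterAct (j a) l ≤ letterAct (j b) l := by
  induction l using ind with
  | h n y =>
    rcases hj (n + 1) with ⟨f, -, h⟩ | ⟨f, -, h⟩
    · rw [letterAct_of_inl (h _), letterAct_of_inl (h _)]
      exact of_le (towerRact_le le_rfl (f.monotone' hab))
    · rw [letterAct_of_inr (h _), letterAct_of_inr (h _)]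
      exact of_le (towerSnoc_le le_rfl (f.monotone' hab))

theorem letterAct_ι (hj : ∀ n, IsPlacedAt S j n) (c : U) (n : ℕ) (y : (tower S₁ S₂ n).carrier) :
    letterAct (j (S.ι c)) (of n y) = of n ((tower S₁ S₂ n).ract y c) := by
  rcases hj (n + 1) with ⟨f, hf, h⟩ | ⟨f, hf, h⟩
  · rw [letterAct_of_inl (h _), hf]
    rfl
  · rw [letterAct_of_inr (h _), hf, ← of_snoc_one n, towerSnoc_ract, mul_one]

/-- The right action of a factor, as an antihomomorphism to the endomaps of the colimit. -/
def factorAct (hj : ∀ n, IsPlacedAt S j n) : S.carrier →* (Function.End (TowerColim S₁ S₂))ᵐᵒᵖ where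
  toFun a := MulOpposite.op (letterAct (j a))
  map_one' := congrArg MulOpposite.op (funext (letterAct_one hj))
  map_mul' a b := congrArg MulOpposite.op (funext (letterAct_mul hj a b))

end FactorAction

variable (S₁ S₂) in
/-- The right action on the colimit of the free product of the monoids `S₁` and `S₂`. -/
def actHom : Monoid.Coprod S₁.carrier S₂.carrier →* (Function.End (TowerColim S₁ S₂))ᵐᵒᵖ :=
  Monoid.Coprod.lift (factorAct isPlacedAt_inl) (factorAct isPlacedAt_inr)

/-- The result `l · p` of the right action of an element of the free product. -/
def act (p : Monoid.Coprod S₁.carrier S₂.carrier) (l : TowerColim S₁ S₂) : TowerColim S₁ S₂ :=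
  (actHom S₁ S₂ p).unop l

theorem act_mul (p q : Monoid.Coprod S₁.carrier S₂.carrier) (l : TowerColim S₁ S₂) :
    act (p * q) l = act q (act p l) := by
  unfold act
  rw [map_mul]
  rfl

theorem act_coprodOf (x : S₁.carrier ⊕ S₂.carrier) (l : TowerColim S₁ S₂) :
    act (coprodOf x) l = letterAct x l := by
  cases x <;> rfl

theorem act_mono (p : Monoid.Coprod S₁.carrier S₂.carrier) : Monotone (act p) := by
  induction p using Monoid.Coprod.induction_on with
  | inl a => exact letterAct_mono (Sum.inl a)
  | inr a => exact letterAct_mono (Sum.inr a)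
  | mul p q hp hq =>
    intro l l' h
    rw [act_mul, act_mul]
    exact hq (hp h)

theorem act_le_of_step {p q : Monoid.Coprod S₁.carrier S₂.carrier} (h : AmalgStep S₁ S₂ p q)
    (l : TowerColim S₁ S₂) : act p l ≤ act q l := by
  have glue (c : U) (l : TowerColim S₁ S₂) :
      letterAct (Sum.inl (S₁.ι c)) l = letterAct (Sum.inr (S₂.ι c)) l := by
    induction l using ind with
    | h n y => rw [letterAct_ι isPlacedAt_inl, letterAct_ι isPlacedAt_inr]
  cases h with
  | inl p q h =>
    simp only [act_mul]
    exact act_mono q (letterAct_le isPlacedAt_inl h _)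
  | inr p q h =>
    simp only [act_mul]
    exact act_mono q (letterAct_le isPlacedAt_inr h _)
  | glue₁ p q c =>
    simp only [act_mul]
    exact act_mono q (glue c _).le
  | glue₂ p q c =>
    simp only [act_mul]
    exact act_mono q (glue c _).ge

theorem act_le_of_gen {p q : Monoid.Coprod S₁.carrier S₂.carrier}
    (h : AmalgProd.mk S₁ S₂ p ≤ AmalgProd.mk S₁ S₂ q) (l : TowerColim S₁ S₂) :
    act p l ≤ act q l :=
  OrdQuot.gen_le (f := fun p => act p l) (fun _ _ k => act_le_of_step k l) h

variable (S₁ S₂) in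
/-- The class of `1 ∈ Y_1`. -/
def base : TowerColim S₁ S₂ := of 0 (1 : S₁.carrier)

/-- The class of `y` in the colimit is `base · φ(y)`. -/
theorem exists_act_base {φ : ∀ n : ℕ, (tower S₁ S₂ n).carrier → AmalgProd S₁ S₂}
    (hφ : ∀ n, TowerEval n (φ n)) (n : ℕ) (y : (tower S₁ S₂ n).carrier) :
    ∃ p, φ n y = AmalgProd.mk S₁ S₂ p ∧ act p (base S₁ S₂) = of n y := by
  induction n with
  | zero =>
    refine ⟨coprodOf (Sum.inl y), ?_, ?_⟩
    · exact (hφ 0).map_bracket (Function.update (fun _ => 1) 0 y)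
    · have hx : place (S₁ := S₁) (S₂ := S₂) 1 (Sum.inl y) = Sum.inl y := rfl
      exact ((act_coprodOf _ _).trans (letterAct_of_inl (n := 0) hx (1 : S₁.carrier))).trans
        (congrArg (of 0) (one_mul (M := S₁.carrier) y))
  | succ n ih =>
    obtain ⟨y, t, rfl⟩ := towerSnoc_surjective n y
    obtain ⟨p, hp, hy⟩ := ih y
    obtain ⟨x, hx⟩ := place_surjective (S₁ := S₁) (S₂ := S₂) (n + 1) (Sum.inr t)
    refine ⟨p * coprodOf x, ?_, ?_⟩
    · have ht := letter_place (n + 1) x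
      rw [hx, Sum.elim_inr] at ht
      rw [TowerEval.map_snoc hφ, hp, ht]
      rfl
    · rw [act_mul, hy, act_coprodOf, letterAct_of_inr hx]

end TowerColim

/-! ### The direct limit property -/

/-- Elements whose images in `S₁ *_U S₂` are comparable are comparable under every cocone over the
tower. -/
theorem TowerEval.cocone_le {φ : ∀ n : ℕ, (tower S₁ S₂ n).carrier → AmalgProd S₁ S₂}
    (hφ : ∀ n, TowerEval n (φ n)) {Z : Type w} [PartialOrder Z]
    (ζ : ∀ n : ℕ, (tower S₁ S₂ n).carrier → Z) (hm : ∀ n, Monotone (ζ n))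
    (hζ : ∀ n y, ζ (n + 1) ((towerMap S₁ S₂ n).toFun y) = ζ n y) {m n : ℕ}
    {y : (tower S₁ S₂ m).carrier} {y' : (tower S₁ S₂ n).carrier} (h : φ m y ≤ φ n y') :
    ζ m y ≤ ζ n y' := by
  obtain ⟨p, hp, hy⟩ := TowerColim.exists_act_base hφ m y
  obtain ⟨q, hq, hy'⟩ := TowerColim.exists_act_base hφ n y'
  rw [hp, hq] at h
  have key := TowerColim.act_le_of_gen h (TowerColim.base S₁ S₂)
  rw [hy, hy'] at key
  refine OrdQuot.gen_le (f := fun a => ζ a.1 a.2) ?_ key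
  rintro _ _ (⟨n, h⟩ | ⟨n, y⟩ | ⟨n, y⟩)
  · exact hm n h
  · exact (hζ n y).ge
  · exact (hζ n y).le

/-- The images of the terms of the tower cover `S₁ *_U S₂`. -/
theorem TowerEval.exists_eq {φ : ∀ n : ℕ, (tower S₁ S₂ n).carrier → AmalgProd S₁ S₂}
    (hφ : ∀ n, TowerEval n (φ n)) (a : AmalgProd S₁ S₂) : ∃ n y, φ n y = a := by
  have mul_letter (x : S₁.carrier ⊕ S₂.carrier) (n : ℕ) (y : (tower S₁ S₂ n).carrier) :
      ∃ m z, φ m z = φ n y * AmalgProd.mk S₁ S₂ (coprodOf x) := by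
    have hx := letter_place (n + 1) x
    rw [← hx]
    rcases place (n + 1) x with t | t
    · exact ⟨n, towerRact n y t, (hφ n).map_ract y t⟩
    · exact ⟨n + 1, towerSnoc n y t, map_snoc hφ n y t⟩
  have mul_mk (p : Monoid.Coprod S₁.carrier S₂.carrier) :
      ∀ (n : ℕ) (y : (tower S₁ S₂ n).carrier), ∃ m z, φ m z = φ n y * AmalgProd.mk S₁ S₂ p := by
    induction p using Monoid.Coprod.induction_on with
    | inl a => exact mul_letter (Sum.inl a)
    | inr a => exact mul_letter (Sum.inr a)
    | mul p q hp hq =>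
      intro n y
      obtain ⟨m, z, hz⟩ := hp n y
      obtain ⟨l, x, hx⟩ := hq m z
      exact ⟨l, x, by rw [hx, hz, mul_assoc]; rfl⟩
  induction a using OrdQuot.ind with
  | h p =>
    obtain ⟨m, z, hz⟩ := mul_mk p 0 (bracket S₁ S₂ (fun _ => 1) 0)
    refine ⟨m, z, hz.trans ?_⟩
    rw [(hφ 0).map_bracket]
    exact (congrArg (· * AmalgProd.mk S₁ S₂ p) (map_one (inl S₁ S₂))).trans (one_mul _)

theorem towerSystem_map_succ {n : ℕ} {m : ℕ} (h : n ≤ m) (y : (tower S₁ S₂ n).carrier) :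
    ((towerSystem S₁ S₂).map (h.trans m.le_succ)).toFun y =
      (towerMap S₁ S₂ m).toFun (((towerSystem S₁ S₂).map h).toFun y) :=
  congrArg (fun f : BiHom (tower S₁ S₂ n) (tower S₁ S₂ (m + 1)) => f.toFun y)
    (Nat.leRec_succ (motive := fun j _ => BiHom (tower S₁ S₂ n) (tower S₁ S₂ j)) _ _ h)

theorem towerSystem_map_self (n : ℕ) (y : (tower S₁ S₂ n).carrier) :
    ((towerSystem S₁ S₂).map (le_refl n)).toFun y = y := by
  rw [(towerSystem S₁ S₂).map_refl]
  rfl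

theorem TowerEval.isDirectLimit
    (φ : ∀ n : ℕ, BiHom (tower S₁ S₂ n) (AmalgProd.biposet S₁ S₂))
    (hφ : ∀ n, TowerEval n (φ n).toFun) :
    BiDirectSystem.IsDirectLimit.{v, v, u, u, w, 0} (towerSystem S₁ S₂)
      (AmalgProd.biposet S₁ S₂) φ := by
  refine ⟨fun i j h => ?_, fun Z ζ hζ => ?_⟩
  · refine BiHom.ext (funext fun y => ?_)
    change (φ j).toFun (((towerSystem S₁ S₂).map h).toFun y) = (φ i).toFun y
    induction j, h using Nat.le_induction with
    | base => exact congrArg (φ i).toFun (towerSystem_map_self i y)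
    | succ m hm ih =>
      exact (congrArg (φ (m + 1)).toFun (towerSystem_map_succ hm y)).trans
        ((map_towerMap hφ m _).trans ih)
  · have hζ' (n : ℕ) (y : (tower S₁ S₂ n).carrier) :
        (ζ (n + 1)).toFun ((towerMap S₁ S₂ n).toFun y) = (ζ n).toFun y := by
      have h := congrArg (fun f => f.toFun y) (hζ n (n + 1) n.le_succ)
      change (ζ (n + 1)).toFun (((towerSystem S₁ S₂).map _).toFun y) = _ at h
      rwa [towerSystem_map_succ le_rfl, towerSystem_map_self] at h
    have hle {m n : ℕ} {y : (tower S₁ S₂ m).carrier} {y' : (tower S₁ S₂ n).carrier}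
        (h : (φ m).toFun y ≤ (φ n).toFun y') : (ζ m).toFun y ≤ (ζ n).toFun y' :=
      cocone_le hφ (fun n => (ζ n).toFun) (fun n _ _ => (ζ n).mono) hζ' h
    -- `ψ` sends `φ_n(y)` to `ζ_n(y)`, which by `hle` does not depend on the representative
    choose ν r hr using exists_eq hφ
    have hr' (n : ℕ) (y : (tower S₁ S₂ n).carrier) :
        (ζ (ν ((φ n).toFun y))).toFun (r ((φ n).toFun y)) = (ζ n).toFun y :=
      le_antisymm (hle (hr _).le) (hle (hr _).ge)
    let ψ : BiHom (AmalgProd.biposet S₁ S₂) Z :=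
      { toFun := fun a => (ζ (ν a)).toFun (r a)
        mono := fun {a a'} h => hle (((hr a).le.trans h).trans (hr a').ge)
        map_lact := fun c a => by
          obtain ⟨n, y, rfl⟩ := exists_eq hφ a
          rw [← (φ n).map_lact, hr', hr']
          exact (ζ n).map_lact c y
        map_ract := fun a c => by
          obtain ⟨n, y, rfl⟩ := exists_eq hφ a
          rw [← (φ n).map_ract, hr', hr']
          exact (ζ n).map_ract y c }
    refine ⟨ψ, fun n => BiHom.ext (funext (hr' n)), fun ψ' hψ' => BiHom.ext (funext fun a => ?_)⟩
    obtain ⟨n, y, rfl⟩ := exists_eq hφ a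
    exact (congrArg (fun f => f.toFun y) (hψ' n)).trans (hr' n y).symm

end TowerProofs

theorem theorem2 {U : Type v} [Monoid U] [PartialOrder U] [MulLeftMono U] [MulRightMono U]
    (S₁ S₂ : PomonoidUnder.{u, v} U)
    (h₁ : ∀ a b : U, S₁.ι a ≤ S₁.ι b ↔ a ≤ b) (h₂ : ∀ a b : U, S₂.ι a ≤ S₂.ι b ↔ a ≤ b) :
    -- there is exactly one family of morphisms `φ_n` with `φ_n [s_1, …, s_n] = (s_1, …, s_n)`
    (∃! φ : ∀ n : ℕ, BiHom (tower S₁ S₂ n) (AmalgProd.biposet S₁ S₂),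
      ∀ n s, (φ n).toFun (bracket S₁ S₂ s n) = AmalgProd.word S₁ S₂ s n) ∧
    -- and it makes `S₁ *_U S₂` the direct limit of the tower
    ∀ φ : ∀ n : ℕ, BiHom (tower S₁ S₂ n) (AmalgProd.biposet S₁ S₂),
      (∀ n s, (φ n).toFun (bracket S₁ S₂ s n) = AmalgProd.word S₁ S₂ s n) →
        BiDirectSystem.IsDirectLimit.{v, v, u, u, w, 0} (towerSystem S₁ S₂)
          (AmalgProd.biposet S₁ S₂) φ := by
  have ext_bracket (φ φ' : ∀ n : ℕ, BiHom (tower S₁ S₂ n) (AmalgProd.biposet S₁ S₂))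
      (h : ∀ n s, (φ n).toFun (bracket S₁ S₂ s n) = AmalgProd.word S₁ S₂ s n)
      (h' : ∀ n s, (φ' n).toFun (bracket S₁ S₂ s n) = AmalgProd.word S₁ S₂ s n) : φ = φ' := by
    refine funext fun n => BiHom.ext (funext fun y => ?_)
    obtain ⟨s, rfl⟩ := bracket_surjective n y
    rw [h, h']
  choose f g hf _ _ using TowerEval.exists_succ (S₁ := S₁) (S₂ := S₂)
  let φ (n : ℕ) : BiHom (tower S₁ S₂ n) (AmalgProd.biposet S₁ S₂) :=
    { toFun := f n
      mono := fun h => (hf n).mono h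
      map_lact := (hf n).map_lact
      map_ract := fun y c => ((hf n).map_ract y ((factor S₁ S₂ (n + 1)).ι c)).trans
        (congrArg (f n y * ·) (AmalgProd.letter_ι (n + 1) c)) }
  have hφ : ∀ n s, (φ n).toFun (bracket S₁ S₂ s n) = AmalgProd.word S₁ S₂ s n :=
    fun n => (hf n).map_bracket
  refine ⟨⟨φ, hφ, fun φ' h' => ext_bracket φ' φ h' hφ⟩, fun φ' h' => ?_⟩
  rw [ext_bracket φ' φ h' hφ]
  exact TowerEval.isDirectLimit φ hf
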